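/- \textbf{Conventions.} All groups are countable and discrete, and sets in a measure space are considered up to null sets. Let $\Lambda,\Gamma$ be countable groups. We say that $\Lambda$ strictly measurably imbeds (SMI) into $\Gamma$ if there are a standard Borel space $\Sigma$ with a nonzero $\sigma$-finite measure $\mu$, a measurable $\mu$-preserving action of $\Lambda\times\Gamma$ on $\Sigma$, and Borel fundamental domains $Y\subset\Sigma$ for the action of $\Lambda$ and $X\subset\Sigma$ for the action of $\Gamma$, that is, $\Sigma=\bigsqcup_{\lambda\in\Lambda}\lambda Y=\bigsqcup_{\gamma\in\Gamma}\gamma X$, such that $\mu(X)<\infty$ and $X\subset Y$. Such a $\Sigma$ is called a coupling, and its index is $\mu(Y)/\mu(X)\in[1,\infty]$. The graph product of groups $\{A_v\}_{v\in V}$ over a simple graph $\Theta$ with vertex set $V$ is the quotient of the free product $*_{v\in V}A_v$ by the relations $[a,b]=1$ for all $a\in A_u$, $b\in A_v$ with $u,v$ adjacent in $\Theta$. The graph $\Theta$ is irreducible if it is not the join of two nonempty full subgraphs, where the join of two graphs is obtained from their disjoint union by connecting every vertex of the first to every vertex of the second by an edge. \textbf{Theorem B.} Let $\Theta$ be a finite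 simple irreducible graph with vertex set $V$. Let $H$ and $G$ be the graph products over $\Theta$ of nontrivial finitely generated vertex groups $\{H_v\}_{v\in V}$ and $\{G_v\}_{v\in V}$, respectively. Suppose that for each $v\in V$, $H_v$ SMI into $G_v$ with a coupling of index $c_v$. Then $H$ SMI into $G$. Moreover, if $c_v=1$ for all $v\in V$, then there is such a coupling of $H$ into $G$ with index $1$; and if $V$ has at least two vertices and $c_v\neq 1$ for some $v\in V$, then there is such a coupling with index $\infty$. -/

import Mathlib

open MeasureTheory
open scoped ENNReal

/-- A *strict measurable imbedding coupling* from `Λ` to `Γ`: a standard Borel space with a nonzero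
measure and a measurable, measure preserving action of `Λ × Γ`, together with a Borel fundamental
domain `Y` for `Λ = Λ × {1}` and a Borel fundamental domain `X` for `Γ = {1} × Γ`, such that `X` has
finite measure and `X ⊆ Y`. Fundamental domains are understood up to null sets, as in
`MeasureTheory.IsFundamentalDomain`. For countable `Γ` the measure is automatically σ-finite, and
its total mass is infinite exactly when `Γ` is infinite. A standard Borel space has at most the
cardinality of the continuum, so spaces in `Type` are enough. -/
structure SMICoupling (Λ Γ : Type*) [Group Λ] [Group Γ] where
  space : Type
  [measurableSpace : MeasurableSpace space]
  [standardBorelSpace : StandardBorelSpace space]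
  μ : Measure space
  measure_ne_zero : μ ≠ 0
  [mulAction : MulAction (Λ × Γ) space]
  [measurableConstSMul : MeasurableConstSMul (Λ × Γ) space]
  [smulInvariantMeasure : SMulInvariantMeasure (Λ × Γ) space μ]
  Y : Set space
  X : Set space
  measurableSet_Y : MeasurableSet Y
  measurableSet_X : MeasurableSet X
  isFundamentalDomain_Y : IsFundamentalDomain (MonoidHom.inl Λ Γ).range Y μ
  isFundamentalDomain_X : IsFundamentalDomain (MonoidHom.inr Λ Γ).range X μ
  measure_X_lt_top : μ X < ∞
  X_subset_Y : X ⊆ Y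

/-- The index `[Γ : Λ] = μ(Y) / μ(X) ∈ [1, ∞]` of a coupling. For countable groups, `μ(X)` is
nonzero and finite, and the ratio does not depend on the choice of the fundamental domains. -/
noncomputable def SMICoupling.index {Λ Γ : Type*} [Group Λ] [Group Γ] (S : SMICoupling Λ Γ) :
    ℝ≥0∞ :=
  S.μ S.Y / S.μ S.X

/-- `Λ` strictly measurably imbeds into `Γ`. -/
def SMI (Λ Γ : Type*) [Group Λ] [Group Γ] : Prop :=
  Nonempty (SMICoupling Λ Γ)

/-- `Λ` strictly measurably imbeds into `Γ` with coupling index `c`. -/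
def SMIWithIndex (Λ Γ : Type*) [Group Λ] [Group Γ] (c : ℝ≥0∞) : Prop :=
  ∃ S : SMICoupling Λ Γ, S.index = c

/-- The graph product of the groups `A v` over the graph `Θ`: the quotient of their free product by
the relations saying that the elements of `A u` commute with those of `A v` for every edge `uv`. -/
abbrev GraphProduct {V : Type*} (Θ : SimpleGraph V) (A : V → Type*) [∀ v, Group (A v)] :=
  Monoid.CoprodI A ⧸ Subgroup.normalClosure
    {r : Monoid.CoprodI A | ∃ (u v : V) (_ : Θ.Adj u v) (a : A u) (b : A v),
      r = Monoid.CoprodI.of a * Monoid.CoprodI.of b *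
        (Monoid.CoprodI.of a)⁻¹ * (Monoid.CoprodI.of b)⁻¹}

/-- `Θ` is the join of its subgraphs `Θ₁` and `Θ₂`: its vertices are those of `Θ₁` and `Θ₂`, and its
edges are those of `Θ₁`, those of `Θ₂`, and all pairs of a vertex of `Θ₁` and a vertex of `Θ₂`. -/
def SimpleGraph.IsJoin {V : Type*} (Θ : SimpleGraph V) (Θ₁ Θ₂ : Θ.Subgraph) : Prop :=
  Θ₁.verts ∪ Θ₂.verts = Set.univ ∧
    ∀ u v, Θ.Adj u v ↔ Θ₁.Adj u v ∨ Θ₂.Adj u v ∨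
      (u ∈ Θ₁.verts ∧ v ∈ Θ₂.verts) ∨ (u ∈ Θ₂.verts ∧ v ∈ Θ₁.verts)

/-- `Θ` is irreducible: it is not the join of two nonempty full (induced) subgraphs. -/
def SimpleGraph.IsIrreducible {V : Type*} (Θ : SimpleGraph V) : Prop :=
  ¬ ∃ Θ₁ Θ₂ : Θ.Subgraph, Θ₁.IsInduced ∧ Θ₂.IsInduced ∧
    Θ₁.verts.Nonempty ∧ Θ₂.verts.Nonempty ∧ Θ.IsJoin Θ₁ Θ₂

/-!
A coupling of `Λ` into `Γ` amounts to a nonzero finite `Λ`-invariant measure on the space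
`NormalizedInjection Λ Γ` of injective maps `f : Λ → Γ` with `f 1 = 1`. If `s` is a point of the
coupling, then the elements `N a` of `Γ` with `(a, N a) • s ∈ X` define such a map
`a ↦ N a * (N 1)⁻¹`, which is injective because the `Λ`-translates of `X ⊆ Y` are disjoint. It does
not change if `s` is replaced by a `Γ`-translate, so the image of the measure on `X` is
`Λ`-invariant (`SMICoupling.exists_invariant_measure`). The index is `1` if and only if almost every
injection is surjective.

Conversely, a measure preserving action of `Λ` on `Ω` with a cocycle `α : Λ × Ω → Γ` such that
`α a x ≠ 1` for `a ≠ 1` gives a coupling on `Ω × Γ` (`exists_coupling_of_cocycle`). The domain `Y`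
consists of the points whose second coordinate is minimal in their `Λ`-orbit, for an enumeration of
`Γ` that starts with `1`, so that it contains `X = Ω × {1}`.

For the graph products, `Ω` is the product of the spaces of injections of the vertex groups, on
which the graph product of the `H v` acts through its projection to the direct product of the `H v`.
The cocycles `(a, x) ↦ x v a` of the vertex groups extend to a cocycle between the graph products
(`GraphProduct.cocycle`), because the action of `H u` does not change the coordinate `x v` for
`u ≠ v`. The cocycle maps a word to a word with the same sequence of vertices
(`GraphProduct.cocycle_wordProd`), and maps nontrivial letters to nontrivial letters. As being
reduced depends only on the sequence of vertices, the normal form theorem for graph products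
(`GraphProduct.eq_nil_of_wordProd_eq_one`) shows that the cocycle does not take the value `1`
outside the identity. That theorem is proved with a representation of the graph product, in which a
reduced word with nontrivial letters has a nonzero matrix coefficient.

If all `x v` are surjective, then so is the cocycle at `x`, which gives index `1`. If for some `v`
the random injection misses `b : G v` with positive probability, then irreducibility gives a vertex
`u ≠ v` that is not adjacent to `v`. For `1 ≠ e : G u`, the cocycle at a point `x` with `b` not in
the range of `x v` takes no value `(e * b) ^ k` with `k ≥ 1`, because in the free product of `G u`
and `G v` this power ends with the letter `b` (`GraphProduct.cocycle_ne_pow`). Hence the sets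
`B × {(e * b) ^ n}`, where `B` is the set of these `x`, have disjoint translates, and `Y` has
infinite measure.
-/

/-! ### Words in a family of groups and graph products -/

section Words

variable {V : Type*} {A : V → Type*} [∀ v, Group (A v)]

/-- The value in a monoid `M` of a word in the vertex groups `A v`, given homomorphisms `A v →* M`.
The letters of the word are multiplied from left to right. -/
def wordProd {M : Type*} [Monoid M] (ι : ∀ v, A v →* M) (l : List (Σ v, A v)) : M :=
  (l.map fun s => ι s.1 s.2).prod

@[simp]
theorem wordProd_nil {M : Type*} [Monoid M] (ι : ∀ v, A v →* M) : wordProd ι [] = 1 := rfl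

@[simp]
theorem wordProd_cons {M : Type*} [Monoid M] (ι : ∀ v, A v →* M) (s : Σ v, A v)
    (l : List (Σ v, A v)) : wordProd ι (s :: l) = ι s.1 s.2 * wordProd ι l := by
  simp [wordProd]

@[simp]
theorem wordProd_append {M : Type*} [Monoid M] (ι : ∀ v, A v →* M) (l l' : List (Σ v, A v)) :
    wordProd ι (l ++ l') = wordProd ι l * wordProd ι l' := by
  simp [wordProd]

theorem map_wordProd {M N : Type*} [Monoid M] [Monoid N] (ι : ∀ v, A v →* M) (f : M →* N)
    (l : List (Σ v, A v)) : f (wordProd ι l) = wordProd (fun v => f.comp (ι v)) l := by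
  simp [wordProd, map_list_prod, Function.comp_def]

end Words

namespace GraphProduct

variable {V : Type*} {Θ : SimpleGraph V} {A : V → Type*} [∀ v, Group (A v)]

/-- The canonical homomorphism from a vertex group to the graph product. -/
def of (Θ : SimpleGraph V) (A : V → Type*) [∀ v, Group (A v)] (v : V) : A v →* GraphProduct Θ A :=
  (QuotientGroup.mk' _).comp Monoid.CoprodI.of

theorem commute_of {u v : V} (h : Θ.Adj u v) (a : A u) (b : A v) :
    Commute (of Θ A u a) (of Θ A v b) := by
  have : of Θ A u a * of Θ A v b * (of Θ A u a)⁻¹ * (of Θ A v b)⁻¹ = 1 :=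
    (QuotientGroup.eq_one_iff _).2 (Subgroup.subset_normalClosure ⟨u, v, h, a, b, rfl⟩)
  exact commutatorElement_eq_one_iff_commute.1 this

/-- The universal property of the graph product: homomorphisms from the vertex groups to a monoid,
with commuting values on the two ends of each edge, extend to the graph product. -/
def lift {M : Type*} [Monoid M] (f : ∀ v, A v →* M)
    (hf : ∀ u v, Θ.Adj u v → ∀ a b, Commute (f u a) (f v b)) : GraphProduct Θ A →* M :=
  QuotientGroup.lift _ (Monoid.CoprodI.lift f) <| by
    refine Subgroup.normalClosure_le_normal ?_
    rintro _ ⟨u, v, h, a, b, rfl⟩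
    have h1 : f u a * f v b * f u a⁻¹ * f v b⁻¹ = 1 := by
      rw [(hf u v h a b).eq, mul_assoc (f v b), ← map_mul, mul_inv_cancel, map_one, mul_one,
        ← map_mul, mul_inv_cancel, map_one]
    simp only [SetLike.mem_coe, MonoidHom.mem_ker, map_mul, Monoid.CoprodI.lift_of]
    rw [← map_inv, ← map_inv, Monoid.CoprodI.lift_of, Monoid.CoprodI.lift_of, h1]

@[simp]
theorem lift_of {M : Type*} [Monoid M] (f : ∀ v, A v →* M)
    (hf : ∀ u v, Θ.Adj u v → ∀ a b, Commute (f u a) (f v b)) (v : V) (a : A v) :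
    lift f hf (of Θ A v a) = f v a :=
  Monoid.CoprodI.lift_of f a

theorem lift_wordProd {M : Type*} [Monoid M] (f : ∀ v, A v →* M)
    (hf : ∀ u v, Θ.Adj u v → ∀ a b, Commute (f u a) (f v b)) (l : List (Σ v, A v)) :
    lift f hf (wordProd (of Θ A) l) = wordProd f l := by
  simp [wordProd, map_list_prod, Function.comp_def]

theorem wordProd_surjective : Function.Surjective (wordProd (of Θ A)) := by
  intro g
  obtain ⟨g, rfl⟩ := QuotientGroup.mk_surjective g
  induction g using Monoid.CoprodI.induction_left with
  | one => exact ⟨[], rfl⟩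
  | mul a x ih =>
    obtain ⟨l, hl⟩ := ih
    refine ⟨⟨_, a⟩ :: l, ?_⟩
    rw [wordProd_cons, hl]
    rfl

instance countable [Countable V] [∀ v, Countable (A v)] : Countable (GraphProduct Θ A) :=
  wordProd_surjective.countable

/-! ### Reduced words -/

/-- Two lists of vertices differ by an elementary shuffle if one arises from the other by swapping
two consecutive vertices that are adjacent in the graph. -/
def Swap (Θ : SimpleGraph V) (w w' : List V) : Prop :=
  ∃ p q u v, Θ.Adj u v ∧ w = p ++ u :: v :: q ∧ w' = p ++ v :: u :: q

theorem Swap.symm {w w' : List V} (h : Swap Θ w w') : Swap Θ w' w := by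
  obtain ⟨p, q, u, v, h, rfl, rfl⟩ := h
  exact ⟨p, q, v, u, h.symm, rfl, rfl⟩

theorem Swap.length_eq {w w' : List V} (h : Swap Θ w w') : w.length = w'.length := by
  obtain ⟨p, q, u, v, -, rfl, rfl⟩ := h
  simp

/-- Shuffle equivalence of lists of vertices. It is symmetric because `Swap` is. -/
abbrev Shuffle (Θ : SimpleGraph V) : List V → List V → Prop :=
  Relation.ReflTransGen (Swap Θ)

theorem Shuffle.length_eq {w w' : List V} (h : Shuffle Θ w w') : w.length = w'.length := by
  induction h with
  | refl => rfl
  | tail _ h ih => exact ih.trans h.length_eq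

/-- A list of vertices is reduced if no shuffle of it has two equal consecutive entries. -/
def Reduced (Θ : SimpleGraph V) (w : List V) : Prop :=
  ∀ p v q, ¬ Shuffle Θ w (p ++ v :: v :: q)

/-- A shuffle of the vertices of a word is induced by a shuffle of the word itself, which does not
change its value in the graph product. -/
theorem exists_word_of_shuffle {l : List (Σ v, A v)} {w : List V}
    (h : Shuffle Θ (l.map Sigma.fst) w) :
    ∃ l' : List (Σ v, A v), l'.map Sigma.fst = w ∧
      wordProd (of Θ A) l' = wordProd (of Θ A) l := by
  induction h with
  | refl => exact ⟨l, rfl, rfl⟩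
  | tail _ h ih =>
    obtain ⟨l', hl', hprod⟩ := ih
    obtain ⟨p, q, u, v, hadj, rfl, rfl⟩ := h
    obtain ⟨lp, l₁, rfl, rfl, h₁⟩ := List.map_eq_append_iff.1 hl'
    obtain ⟨⟨u', a⟩, l₂, rfl, rfl, h₂⟩ := List.map_eq_cons_iff.1 h₁
    obtain ⟨⟨v', b⟩, lq, rfl, rfl, rfl⟩ := List.map_eq_cons_iff.1 h₂
    refine ⟨lp ++ ⟨v', b⟩ :: ⟨u', a⟩ :: lq, by simp, ?_⟩
    rw [← hprod]
    simp only [wordProd_append, wordProd_cons]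
    rw [← mul_assoc (of Θ A v' b), ← (commute_of hadj a b).eq, mul_assoc]

/-- Every element of a graph product is the value of a reduced word with nontrivial letters, for
instance of any word of minimal length. -/
theorem exists_reduced (g : GraphProduct Θ A) :
    ∃ l : List (Σ v, A v), wordProd (of Θ A) l = g ∧ (∀ s ∈ l, s.2 ≠ 1) ∧
      Reduced Θ (l.map Sigma.fst) := by
  classical
  have hex : ∃ n, ∃ l : List (Σ v, A v), l.length = n ∧ wordProd (of Θ A) l = g :=
    let ⟨l, hl⟩ := wordProd_surjective g
    ⟨_, l, rfl, hl⟩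
  obtain ⟨l, hlen, hl⟩ := Nat.find_spec hex
  have hmin : ∀ l' : List (Σ v, A v), wordProd (of Θ A) l' = g → l.length ≤ l'.length :=
    fun l' h' => hlen ▸ Nat.find_min' hex ⟨l', rfl, h'⟩
  refine ⟨l, hl, fun s hs h1 => ?_, fun p v q hsh => ?_⟩
  · obtain ⟨p, q, rfl⟩ := List.append_of_mem hs
    have := hmin (p ++ q) (by rw [← hl]; simp [h1])
    simp at this
  · obtain ⟨l', hl', hprod⟩ := exists_word_of_shuffle (A := A) hsh
    have hlen' : l'.length = l.length := by
      rw [← List.length_map (f := Sigma.fst), hl', ← hsh.length_eq, List.length_map]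
    obtain ⟨lp, l₁, rfl, rfl, h₁⟩ := List.map_eq_append_iff.1 hl'
    obtain ⟨⟨u', a⟩, l₂, rfl, rfl, h₂⟩ := List.map_eq_cons_iff.1 h₁
    obtain ⟨⟨v', b⟩, lq, rfl, h₃, rfl⟩ := List.map_eq_cons_iff.1 h₂
    obtain rfl : v' = u' := h₃
    have := hmin (lp ++ ⟨v', a * b⟩ :: lq) (by rw [← hl, ← hprod]; simp [mul_assoc])
    rw [← hlen'] at this
    simp at this

/-! ### The normal form theorem for graph products -/

section NormalForm

variable (Θ) (R : Type*) [CommRing R]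

/-- The functions on lists of vertices that are invariant under shuffles and vanish on all lists
with two equal consecutive entries: the dual of the quotient of the free algebra on the vertices by
the relations `v ^ 2 = 0` for all `v`, and `u * v = v * u` for `u`, `v` adjacent. -/
abbrev ShuffleFun : Type _ :=
  {φ : List V → R // (∀ w w', Swap Θ w w' → φ w = φ w') ∧ ∀ p v q, φ (p ++ v :: v :: q) = 0}

variable {Θ R}

/-- The operator `1 + t • N v` on `ShuffleFun Θ R`, where `N v` is the transpose of right
multiplication by `v`. As `N v` has square zero, `t ↦ elem v t` is a one-parameter group. -/
def ShuffleFun.elem (v : V) (t : R) (φ : ShuffleFun Θ R) : ShuffleFun Θ R :=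
  ⟨fun w => φ.1 w + t * φ.1 (w ++ [v]), by
    refine ⟨?_, fun p v' q => ?_⟩
    · rintro _ _ ⟨p, q, u, v', h, rfl, rfl⟩
      beta_reduce
      rw [φ.2.1 _ _ ⟨p, q, u, v', h, rfl, rfl⟩,
        φ.2.1 (p ++ u :: v' :: q ++ [v]) (p ++ v' :: u :: q ++ [v])
          ⟨p, q ++ [v], u, v', h, by simp, by simp⟩]
    · simp only [List.append_assoc, List.cons_append, φ.2.2, mul_zero, add_zero]⟩

theorem ShuffleFun.elem_apply (v : V) (t : R) (φ : ShuffleFun Θ R) (w : List V) :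
    (φ.elem v t).1 w = φ.1 w + t * φ.1 (w ++ [v]) := rfl

theorem ShuffleFun.elem_zero (v : V) (φ : ShuffleFun Θ R) : φ.elem v 0 = φ :=
  Subtype.ext <| funext fun w => by simp [elem_apply]

theorem ShuffleFun.elem_elem (v : V) (s t : R) (φ : ShuffleFun Θ R) :
    (φ.elem v t).elem v s = φ.elem v (s + t) :=
  Subtype.ext <| funext fun w => by
    have := φ.2.2 w v []
    simp only [elem_apply, List.append_assoc, List.cons_append, List.nil_append, this]
    ring

theorem ShuffleFun.elem_comm {u v : V} (h : Θ.Adj u v) (s t : R) (φ : ShuffleFun Θ R) :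
    (φ.elem v t).elem u s = (φ.elem u s).elem v t :=
  Subtype.ext <| funext fun w => by
    have := φ.2.1 _ _ ⟨w, [], u, v, h, rfl, rfl⟩
    simp only [elem_apply, List.append_assoc, List.cons_append, List.nil_append, this]
    ring

open Classical in
/-- The indicator function of the shuffle class of a reduced list of vertices. -/
noncomputable def ShuffleFun.indicator (R : Type*) [CommRing R] {w : List V} (hw : Reduced Θ w) :
    ShuffleFun Θ R :=
  ⟨fun w' => if Shuffle Θ w w' then 1 else 0,
    fun _ _ h => if_congr ⟨fun h' => h'.tail h, fun h' => h'.tail h.symm⟩ rfl rfl,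
    fun p v q => if_neg (hw p v q)⟩

variable [DecidableEq V] (e : ∀ v, A v → R)

/-- The vertex group `A v` acts on `(∀ v, A v) × ShuffleFun Θ R` by translation of the coordinate
`x v` and, on the second factor, by the additive coboundary `(a, x) ↦ e v (a * x v) - e v (x v)`
composed with the one-parameter group `ShuffleFun.elem v`. -/
def shuffleAct (Θ : SimpleGraph V) (v : V) :
    A v →* Function.End ((∀ v, A v) × ShuffleFun Θ R) where
  toFun a := fun p => (Pi.mulSingle v a * p.1, p.2.elem v (e v (a * p.1 v) - e v (p.1 v)))
  map_one' := by
    funext p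
    change (_, _) = p
    simp [ShuffleFun.elem_zero]
  map_mul' a b := by
    funext p
    change (_, _) = (_, _)
    simp only [Pi.mulSingle_mul, mul_assoc, Pi.mul_apply, Pi.mulSingle_eq_same,
      ShuffleFun.elem_elem, sub_add_sub_cancel]

theorem shuffleAct_apply (v : V) (a : A v) (p : (∀ v, A v) × ShuffleFun Θ R) :
    shuffleAct e Θ v a p =
      (Pi.mulSingle v a * p.1, p.2.elem v (e v (a * p.1 v) - e v (p.1 v))) := rfl

theorem commute_shuffleAct {u v : V} (h : Θ.Adj u v) (a : A u) (b : A v) :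
    Commute (shuffleAct e Θ u a) (shuffleAct e Θ v b) := by
  have huv := h.ne
  funext p
  change shuffleAct e Θ u a (shuffleAct e Θ v b p) = shuffleAct e Θ v b (shuffleAct e Θ u a p)
  simp only [shuffleAct_apply, Pi.mul_apply, Pi.mulSingle_eq_of_ne huv,
    Pi.mulSingle_eq_of_ne huv.symm, one_mul, ShuffleFun.elem_comm h, ← mul_assoc,
    (Pi.mulSingle_commute huv a b).eq]

/-- The leading coefficients of a word acting on a function `φ` supported on lists of length `n`:
only the full word contributes to the values at lists of complementary length. -/
theorem wordProd_shuffleAct_apply [IsDomain R] (he : ∀ v, Function.Injective (e v)) (n : ℕ)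
    {φ : ShuffleFun Θ R} (hφ : ∀ w, w.length ≠ n → φ.1 w = 0) (x : ∀ v, A v)
    (l : List (Σ v, A v)) (hl : ∀ s ∈ l, s.2 ≠ 1) :
    (∀ w, w.length + l.length < n → (wordProd (shuffleAct e Θ) l (x, φ)).2.1 w = 0) ∧
      ∃ T : R, T ≠ 0 ∧ ∀ w, w.length + l.length = n →
        (wordProd (shuffleAct e Θ) l (x, φ)).2.1 w = T * φ.1 (w ++ l.map Sigma.fst) := by
  induction l with
  | nil => exact ⟨fun w hw => hφ w (by simpa using hw.ne), 1, one_ne_zero, fun w _ => by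
      rw [List.map_nil, List.append_nil, one_mul]
      rfl⟩
  | cons s l ih =>
    obtain ⟨ih₀, T, hT, ih₁⟩ := ih fun s hs => hl s (List.mem_cons_of_mem _ hs)
    obtain ⟨v, a⟩ := s
    rw [wordProd_cons]
    change (∀ w, _ → (shuffleAct e Θ v a (wordProd (shuffleAct e Θ) l (x, φ))).2.1 w = 0) ∧
      ∃ T : R, T ≠ 0 ∧ ∀ w, _ →
        (shuffleAct e Θ v a (wordProd (shuffleAct e Θ) l (x, φ))).2.1 w = _
    generalize wordProd (shuffleAct e Θ) l (x, φ) = p at ih₀ ih₁ ⊢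
    simp only [shuffleAct_apply, ShuffleFun.elem_apply, List.length_cons]
    refine ⟨fun w hw => ?_, (e v (a * p.1 v) - e v (p.1 v)) * T, mul_ne_zero ?_ hT,
      fun w hw => ?_⟩
    · rw [ih₀ w (by omega), ih₀ (w ++ [v]) (by simp; omega), mul_zero, add_zero]
    · rw [sub_ne_zero]
      intro h
      exact hl ⟨v, a⟩ List.mem_cons_self (mul_eq_right.1 (he v h))
    · rw [ih₀ w (by omega), ih₁ (w ++ [v]) (by simp; omega), zero_add, mul_assoc]
      simp

end NormalForm

/-- **Normal form theorem**: a nonempty reduced word with nontrivial letters has a nontrivial value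
in the graph product. -/
theorem eq_nil_of_wordProd_eq_one {l : List (Σ v, A v)} (hl : ∀ s ∈ l, s.2 ≠ 1)
    (hred : Reduced Θ (l.map Sigma.fst)) (h : wordProd (of Θ A) l = 1) : l = [] := by
  classical
  by_contra hne
  -- The representation needs injections of the vertex groups into an integral domain.
  let R := MvPolynomial (Σ v, A v) ℤ
  let e : ∀ v, A v → R := fun v a => MvPolynomial.X ⟨v, a⟩
  have he : ∀ v, Function.Injective (e v) := fun v =>
    (MvPolynomial.X_injective).comp sigma_mk_injective
  let φ : ShuffleFun Θ R := ShuffleFun.indicator R hred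
  have hφ : ∀ w, w.length ≠ l.length → φ.1 w = 0 := fun w hw =>
    if_neg fun hs => hw (by rw [← hs.length_eq, List.length_map])
  obtain ⟨-, T, hT, hcoef⟩ := wordProd_shuffleAct_apply e he l.length hφ 1 l hl
  have h1 : wordProd (shuffleAct e Θ) l = 1 := by
    rw [← lift_wordProd (Θ := Θ) (shuffleAct e Θ) (fun u v h => commute_shuffleAct e h), h, map_one]
  have h2 := hcoef [] (by simp)
  rw [h1] at h2
  have h3 : φ.1 ([] ++ l.map Sigma.fst) = 1 := if_pos Relation.ReflTransGen.refl
  have h4 : φ.1 [] = 0 := hφ [] fun h => hne (List.length_eq_zero_iff.1 h.symm)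
  rw [h3, mul_one] at h2
  exact hT (h2.symm.trans h4)

end GraphProduct

/-! ### The space of normalized injections -/

/-- The space of injective maps `f : Λ → Γ` with `f 1 = 1`. -/
def NormalizedInjection (Λ Γ : Type*) [Group Λ] [Group Γ] : Type _ :=
  {f : Λ → Γ // Function.Injective f ∧ f 1 = 1}

namespace NormalizedInjection

variable {Λ Γ : Type*} [Group Λ] [Group Γ]

instance : FunLike (NormalizedInjection Λ Γ) Λ Γ where
  coe := Subtype.val
  coe_injective := Subtype.val_injective

theorem injective (f : NormalizedInjection Λ Γ) : Function.Injective f := f.2.1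

@[simp]
theorem map_one (f : NormalizedInjection Λ Γ) : f 1 = 1 := f.2.2

/-- `Λ` acts on normalized injections by translating the argument and normalizing again. Then
`(a, f) ↦ f a` is a cocycle for this action. -/
instance : MulAction Λ (NormalizedInjection Λ Γ) where
  smul a f := ⟨fun x => f (x * a) * (f a)⁻¹,
    fun x y h => mul_right_cancel (f.injective (mul_right_cancel h)), by simp⟩
  one_smul f := DFunLike.ext _ _ fun x => by
    change f (x * 1) * (f 1)⁻¹ = f x
    simp
  mul_smul a b f := DFunLike.ext _ _ fun x => by
    change f (x * (a * b)) * (f (a * b))⁻¹ = f (x * a * b) * (f b)⁻¹ * (f (a * b) * (f b)⁻¹)⁻¹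
    simp [mul_assoc]

theorem smul_apply (a : Λ) (f : NormalizedInjection Λ Γ) (x : Λ) :
    (a • f) x = f (x * a) * (f a)⁻¹ := rfl

theorem apply_mul (f : NormalizedInjection Λ Γ) (a b : Λ) : f (a * b) = (b • f) a * f b := by
  simp [smul_apply]

/-- The σ-algebra generated by the evaluations, where `Γ` is discrete. -/
instance : MeasurableSpace (NormalizedInjection Λ Γ) :=
  letI : MeasurableSpace Γ := ⊤
  inferInstanceAs (MeasurableSpace {f : Λ → Γ // Function.Injective f ∧ f 1 = 1})

theorem measurableSet_apply_eq (a : Λ) (b : Γ) :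
    MeasurableSet {f : NormalizedInjection Λ Γ | f a = b} := by
  let mΓ : MeasurableSpace Γ := ⊤
  have h : Measurable fun f : NormalizedInjection Λ Γ => f.1 a :=
    (measurable_pi_apply a).comp measurable_subtype_coe
  exact h (MeasurableSpace.measurableSet_top (s := {b}))

theorem measurable_of_apply [Countable Γ] {Ω : Type*} [MeasurableSpace Ω]
    {F : Ω → NormalizedInjection Λ Γ} (hF : ∀ a b, MeasurableSet {x | F x a = b}) :
    Measurable F := by
  let mΓ : MeasurableSpace Γ := ⊤
  exact Measurable.subtype_mk (measurable_pi_lambda (fun x => (F x : Λ → Γ)) fun a =>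
    measurable_to_countable' fun b => hF a b)

instance [Countable Λ] [Countable Γ] : StandardBorelSpace (NormalizedInjection Λ Γ) := by
  let mΓ : MeasurableSpace Γ := ⊤
  have : DiscreteMeasurableSpace Γ := ⟨fun _ => trivial⟩
  refine MeasurableSet.standardBorel (α := Λ → Γ)
    (s := {f : Λ → Γ | Function.Injective f ∧ f 1 = 1}) ?_
  have : {f : Λ → Γ | Function.Injective f ∧ f 1 = 1} =
      (⋂ a, ⋂ b, {f | f a = f b → a = b}) ∩ {f | f 1 = 1} := by
    ext f
    simp [Function.Injective]
  rw [this]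
  refine (MeasurableSet.iInter fun a => MeasurableSet.iInter fun b => ?_).inter
    (measurable_pi_apply 1 (MeasurableSet.singleton 1))
  by_cases hab : a = b
  · simp [hab]
  · have h : {f : Λ → Γ | f a = f b → a = b} = {f | f a = f b}ᶜ := by
      ext f
      simp [hab]
    rw [h]
    exact (measurableSet_eq_fun (measurable_pi_apply a) (measurable_pi_apply b)).compl

instance [Countable Γ] : MeasurableConstSMul Λ (NormalizedInjection Λ Γ) where
  measurable_const_smul a := measurable_of_apply fun x b => by
    have : {f : NormalizedInjection Λ Γ | (a • f) x = b} =
        ⋃ c, {f | f (x * a) = b * c} ∩ {f | f a = c} := by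
      ext f
      simp [smul_apply, mul_inv_eq_iff_eq_mul]
    rw [this]
    exact MeasurableSet.iUnion fun c =>
      (measurableSet_apply_eq _ _).inter (measurableSet_apply_eq _ _)

end NormalizedInjection

/-! ### From couplings to random injections -/

theorem MeasureTheory.IsFundamentalDomain.ae_existsUnique {G α : Type*} [Group G] [Countable G]
    [MulAction G α] [MeasurableSpace α] {s : Set α} {μ : Measure α}
    (h : IsFundamentalDomain G s μ) : ∀ᵐ x ∂μ, ∃! g : G, g • x ∈ s := by
  have h2 : ∀ᵐ x ∂μ, ∀ g g' : G, g • x ∈ s → g' • x ∈ s → g = g' := by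
    simp only [ae_all_iff]
    intro g g'
    by_cases hg : g = g'
    · simp [hg]
    · have := h.aedisjoint (inv_injective.ne hg)
      refine measure_mono_null (fun x hx => ?_) this
      simp only [hg, imp_false, Set.mem_compl_iff, Set.mem_ofPred_eq, not_forall,
        not_not] at hx
      simpa [Set.mem_smul_set_iff_inv_smul_mem] using hx
  filter_upwards [h.ae_covers, h2] with x ⟨g, hg⟩ hx
  exact ⟨g, hg, fun g' hg' => hx _ _ hg' hg⟩

theorem MeasureTheory.ae_forall_smul {G α : Type*} [Group G] [Countable G] [MulAction G α]
    [MeasurableSpace α] {μ : Measure α} [MeasurableConstSMul G α] [SMulInvariantMeasure G α μ]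
    {p : α → Prop} (h : ∀ᵐ x ∂μ, p x) : ∀ᵐ x ∂μ, ∀ g : G, p (g • x) :=
  ae_all_iff.2 fun g => (measurePreserving_smul g μ).quasiMeasurePreserving.ae h

namespace SMICoupling

attribute [local instance] measurableSpace standardBorelSpace mulAction measurableConstSMul
  smulInvariantMeasure

variable {Λ Γ : Type*} [Group Λ] [Group Γ] (S : SMICoupling Λ Γ)

theorem smul_smul_pair (a a' : Λ) (b b' : Γ) (s : S.space) :
    (a, b) • (a', b') • s = (a * a', b * b') • s := by
  rw [smul_smul, Prod.mk_mul_mk]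

theorem ae_existsUnique_X [Countable Λ] [Countable Γ] :
    ∀ᵐ s ∂S.μ, ∀ a : Λ, ∃! b : Γ, (a, b) • s ∈ S.X := by
  have h1 : ∀ᵐ s ∂S.μ, ∃! b : Γ, ((1 : Λ), b) • s ∈ S.X := by
    filter_upwards [S.isFundamentalDomain_X.ae_existsUnique] with s hs
    obtain ⟨⟨_, b, rfl⟩, hb, hu⟩ := hs
    refine ⟨b, hb, fun b' hb' => ?_⟩
    simpa using hu ⟨_, b', rfl⟩ hb'
  filter_upwards [ae_forall_smul (G := Λ × Γ) h1] with s hs a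
  simpa [smul_smul_pair] using hs (a, 1)

theorem ae_existsUnique_Y [Countable Λ] [Countable Γ] :
    ∀ᵐ s ∂S.μ, ∀ b : Γ, ∃! a : Λ, (a, b) • s ∈ S.Y := by
  have h1 : ∀ᵐ s ∂S.μ, ∃! a : Λ, (a, (1 : Γ)) • s ∈ S.Y := by
    filter_upwards [S.isFundamentalDomain_Y.ae_existsUnique] with s hs
    obtain ⟨⟨_, b, rfl⟩, hb, hu⟩ := hs
    refine ⟨b, hb, fun b' hb' => ?_⟩
    simpa using hu ⟨_, b', rfl⟩ hb'
  filter_upwards [ae_forall_smul (G := Λ × Γ) h1] with s hs b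
  simpa [smul_smul_pair] using hs (1, b)

theorem measure_X_ne_zero [Countable Γ] : S.μ S.X ≠ 0 := by
  have : Countable (MonoidHom.inr Λ Γ).range :=
    (MonoidHom.inr Λ Γ).rangeRestrict_surjective.countable
  exact S.isFundamentalDomain_X.measure_ne_zero S.measure_ne_zero

/-- The index of a coupling is one if and only if the two fundamental domains agree. -/
theorem index_eq_one_iff [Countable Γ] : S.index = 1 ↔ S.μ (S.Y \ S.X) = 0 := by
  rw [index, ENNReal.div_eq_one_iff S.measure_X_ne_zero S.measure_X_lt_top.ne,
    measure_sdiff S.X_subset_Y S.measurableSet_X.nullMeasurableSet S.measure_X_lt_top.ne,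
    tsub_eq_zero_iff_le]
  exact ⟨fun h => h.le, fun h => h.antisymm (measure_mono S.X_subset_Y)⟩

/-- The points `s` such that the pairs `(a, b)` with `(a, b) • s ∈ X` form the graph of an injective
function of `a`. These are almost all points. -/
def goodSet : Set S.space :=
  {s | (∀ a : Λ, ∃! b : Γ, (a, b) • s ∈ S.X) ∧
    ∀ (a a' : Λ) (b : Γ), (a, b) • s ∈ S.X → (a', b) • s ∈ S.X → a = a'}

theorem ae_mem_goodSet [Countable Λ] [Countable Γ] : ∀ᵐ s ∂S.μ, s ∈ S.goodSet := by
  filter_upwards [S.ae_existsUnique_X, S.ae_existsUnique_Y] with s hX hY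
  exact ⟨hX, fun a a' b h h' => (hY b).unique (S.X_subset_Y h) (S.X_subset_Y h')⟩

theorem measurableSet_smul_mem_X (g : Λ × Γ) : MeasurableSet {s | g • s ∈ S.X} :=
  measurable_const_smul g S.measurableSet_X

theorem measurableSet_goodSet [Countable Λ] [Countable Γ] : MeasurableSet S.goodSet := by
  have : S.goodSet = (⋂ a : Λ, ⋃ b : Γ, {s | (a, b) • s ∈ S.X} ∩
      ⋂ b' : Γ, {s | (a, b') • s ∈ S.X → b' = b}) ∩
      ⋂ a : Λ, ⋂ a' : Λ, ⋂ b : Γ, {s | (a, b) • s ∈ S.X → (a', b) • s ∈ S.X → a = a'} := by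
    ext s
    simp [goodSet, ExistsUnique]
  rw [this]
  refine (MeasurableSet.iInter fun a => MeasurableSet.iUnion fun b =>
    (S.measurableSet_smul_mem_X _).inter <| MeasurableSet.iInter fun b' => ?_).inter <|
    MeasurableSet.iInter fun a => MeasurableSet.iInter fun a' => MeasurableSet.iInter fun b => ?_
  · exact (S.measurableSet_smul_mem_X _).imp (MeasurableSet.const _)
  · exact (S.measurableSet_smul_mem_X _).imp
      ((S.measurableSet_smul_mem_X _).imp (MeasurableSet.const _))

theorem smul_mem_goodSet {s : S.space} (hs : s ∈ S.goodSet) (g : Λ × Γ) : g • s ∈ S.goodSet := by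
  obtain ⟨c, d⟩ := g
  constructor
  · intro a
    obtain ⟨b, hb, hu⟩ := hs.1 (a * c)
    refine ⟨b * d⁻¹, by simpa [smul_smul_pair] using hb, fun b' hb' => ?_⟩
    beta_reduce at hb'
    rw [smul_smul_pair] at hb'
    exact eq_mul_inv_of_mul_eq (hu _ hb')
  · intro a a' b h h'
    rw [smul_smul_pair] at h h'
    exact mul_right_cancel (hs.2 _ _ _ h h')

/-- Every good point `s` defines a normalized injection: up to normalization, it maps `a` to the
element `b` with `(a, b) • s ∈ X`. -/
theorem exists_injection [Countable Λ] [Countable Γ] :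
    ∃ F : S.space → NormalizedInjection Λ Γ, Measurable F ∧
      ∀ s ∈ S.goodSet, ∀ a b, F s a = b ↔ ∃ c : Γ, ((1 : Λ), c) • s ∈ S.X ∧ (a, b * c) • s ∈ S.X := by
  have hex : ∀ s ∈ S.goodSet, ∃ f : NormalizedInjection Λ Γ, ∀ a b,
      f a = b ↔ ∃ c : Γ, ((1 : Λ), c) • s ∈ S.X ∧ (a, b * c) • s ∈ S.X := by
    rintro s ⟨h1, h2⟩
    choose N hN hNu using h1
    refine ⟨⟨fun a => N a * (N 1)⁻¹, fun a a' h => ?_, by simp⟩, fun a b => ?_⟩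
    · have h' : N a = N a' := mul_right_cancel h
      exact h2 a a' (N a) (hN a) (h' ▸ hN a')
    · change N a * (N 1)⁻¹ = b ↔ _
      rw [mul_inv_eq_iff_eq_mul]
      constructor
      · exact fun h => ⟨N 1, hN 1, h ▸ hN a⟩
      · rintro ⟨c, hc, hac⟩
        rw [← hNu 1 c hc, ← hNu a _ hac]
  have hne : ∃ s, s ∈ S.goodSet := by
    by_contra! h
    exact S.measure_ne_zero (by
      have := S.ae_mem_goodSet
      simpa [h] using this)
  obtain ⟨s₀, hs₀⟩ := hne
  have : Nonempty (NormalizedInjection Λ Γ) := ⟨(hex s₀ hs₀).choose⟩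
  choose! F hF using hex
  classical
  refine ⟨fun s => if s ∈ S.goodSet then F s else F s₀, ?_, fun s hs => by simpa [hs] using hF s hs⟩
  refine NormalizedInjection.measurable_of_apply fun a b => ?_
  have : {s | (if s ∈ S.goodSet then F s else F s₀) a = b} =
      (S.goodSet ∩ ⋃ c : Γ, {s | ((1 : Λ), c) • s ∈ S.X} ∩ {s | (a, b * c) • s ∈ S.X}) ∪
      (S.goodSetᶜ ∩ {_s | F s₀ a = b}) := by
    ext s
    by_cases hs : s ∈ S.goodSet <;> simp [hs, hF]
  rw [this]
  exact (S.measurableSet_goodSet.inter (MeasurableSet.iUnion fun c =>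
    (S.measurableSet_smul_mem_X _).inter (S.measurableSet_smul_mem_X _))).union
    (S.measurableSet_goodSet.compl.inter (MeasurableSet.const _))

/-- A coupling of `Λ` into `Γ` gives a nonzero finite `Λ`-invariant measure on the normalized
injections `Λ → Γ`. The coupling has index one if and only if almost every injection is
surjective. -/
theorem exists_invariant_measure [Countable Λ] [Countable Γ] :
    ∃ P : Measure (NormalizedInjection Λ Γ), IsFiniteMeasure P ∧ P ≠ 0 ∧
      SMulInvariantMeasure Λ (NormalizedInjection Λ Γ) P ∧
      (S.index = 1 ↔ ∀ᵐ f : NormalizedInjection Λ Γ ∂P, Function.Surjective f) := by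
  obtain ⟨F, hFm, hF⟩ := S.exists_injection
  have : Countable (MonoidHom.inr Λ Γ).range :=
    (MonoidHom.inr Λ Γ).rangeRestrict_surjective.countable
  have : IsFiniteMeasure (S.μ.restrict S.X) := ⟨by simpa using S.measure_X_lt_top⟩
  have hFright : ∀ s ∈ S.goodSet, ∀ d : Γ, F (((1 : Λ), d) • s) = F s := by
    intro s hs d
    refine DFunLike.ext _ _ fun a => ?_
    rw [hF _ (S.smul_mem_goodSet hs _)]
    obtain ⟨c, hc, hac⟩ := (hF s hs a _).1 rfl
    exact ⟨c * d⁻¹, by simpa [smul_smul_pair] using hc, by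
      simpa [smul_smul_pair, mul_assoc] using hac⟩
  have hFleft : ∀ s ∈ S.goodSet, ∀ d : Λ, F ((d, (1 : Γ)) • s) = d • F s := by
    intro s hs d
    refine DFunLike.ext _ _ fun a => ?_
    rw [hF _ (S.smul_mem_goodSet hs _), NormalizedInjection.smul_apply]
    obtain ⟨c, hc, hac⟩ := (hF s hs (a * d) _).1 rfl
    obtain ⟨c', hc', hac'⟩ := (hF s hs d _).1 rfl
    obtain rfl : c = c' := (hs.1 1).unique hc hc'
    exact ⟨F s d * c, by simpa [smul_smul_pair] using hac', by
      simpa [smul_smul_pair, mul_assoc] using hac⟩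
  have hsurj : MeasurableSet {f : NormalizedInjection Λ Γ | Function.Surjective f} := by
    have : {f : NormalizedInjection Λ Γ | Function.Surjective f} = ⋂ b, ⋃ a, {f | f a = b} := by
      ext f
      simp [Function.Surjective]
    rw [this]
    exact MeasurableSet.iInter fun b => MeasurableSet.iUnion fun a =>
      NormalizedInjection.measurableSet_apply_eq a b
  refine ⟨(S.μ.restrict S.X).map F, inferInstance, ?_, ⟨fun d A hA => ?_⟩, ?_⟩
  · rw [Ne, Measure.map_eq_zero_iff hFm.aemeasurable, Measure.restrict_eq_zero]
    exact S.measure_X_ne_zero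
  · -- The set of good points whose injection lies in `A` is `Γ`-invariant, so its intersections with
    -- the two `Γ`-fundamental domains `X` and `(d, 1) • X` have the same measure.
    have hdA := measurable_const_smul d hA
    rw [Measure.map_apply hFm hdA, Measure.map_apply hFm hA,
      Measure.restrict_apply (hFm hdA), Measure.restrict_apply (hFm hA)]
    let B : Set S.space := S.goodSet ∩ F ⁻¹' A
    have hB : MeasurableSet B := S.measurableSet_goodSet.inter (hFm hA)
    have hBinv : ∀ g : (MonoidHom.inr Λ Γ).range, (fun s => g • s) ⁻¹' B = B := by
      rintro ⟨_, c, rfl⟩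
      ext s
      change (((1 : Λ), c) • s ∈ S.goodSet ∧ F (((1 : Λ), c) • s) ∈ A) ↔ s ∈ S.goodSet ∧ F s ∈ A
      constructor
      · rintro ⟨h1, h2⟩
        have hs : s ∈ S.goodSet := by
          simpa [smul_smul_pair, ← Prod.one_eq_mk] using S.smul_mem_goodSet h1 (1, c⁻¹)
        exact ⟨hs, hFright s hs c ▸ h2⟩
      · rintro ⟨h1, h2⟩
        exact ⟨S.smul_mem_goodSet h1 _, by rwa [hFright s h1 c]⟩
    have hdX : IsFundamentalDomain (MonoidHom.inr Λ Γ).range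
        ((fun s => (d⁻¹, (1 : Γ)) • s) ⁻¹' S.X) S.μ :=
      S.isFundamentalDomain_X.preimage_of_equiv
        (measurePreserving_smul _ _).quasiMeasurePreserving
        (e := id) Function.bijective_id (by
          rintro ⟨_, c, rfl⟩ s
          change (d⁻¹, (1 : Γ)) • ((1 : Λ), c) • s = ((1 : Λ), c) • (d⁻¹, (1 : Γ)) • s
          simp [smul_smul_pair])
    calc S.μ (F ⁻¹' ((fun f => d • f) ⁻¹' A) ∩ S.X)
        = S.μ ((fun s => (d, (1 : Γ)) • s) ⁻¹' (B ∩ (fun s => (d⁻¹, (1 : Γ)) • s) ⁻¹' S.X)) := by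
          refine measure_congr ?_
          filter_upwards [S.ae_mem_goodSet] with s hs
          refine propext ?_
          change (d • F s ∈ A ∧ s ∈ S.X) ↔ ((d, (1 : Γ)) • s ∈ S.goodSet ∧
            F ((d, (1 : Γ)) • s) ∈ A) ∧ (d⁻¹, (1 : Γ)) • (d, (1 : Γ)) • s ∈ S.X
          simp [hFleft s hs, S.smul_mem_goodSet hs, smul_smul_pair, ← Prod.one_eq_mk]
      _ = S.μ (B ∩ (fun s => (d⁻¹, (1 : Γ)) • s) ⁻¹' S.X) :=
          (measurePreserving_smul (d, (1 : Γ)) S.μ).measure_preimage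
            (hB.inter (S.measurableSet_smul_mem_X _)).nullMeasurableSet
      _ = S.μ (B ∩ S.X) := hdX.measure_set_eq S.isFundamentalDomain_X hB hBinv
      _ = S.μ (F ⁻¹' A ∩ S.X) := by
          refine measure_congr ?_
          filter_upwards [S.ae_mem_goodSet] with s hs
          refine propext ?_
          change ((s ∈ S.goodSet ∧ F s ∈ A) ∧ s ∈ S.X) ↔ (F s ∈ A ∧ s ∈ S.X)
          simp [hs]
  · rw [S.index_eq_one_iff, ae_map_iff hFm.aemeasurable hsurj, ae_restrict_iff' S.measurableSet_X]
    constructor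
    · intro h
      have h' : ∀ᵐ s ∂S.μ, ¬ (s ∈ S.Y \ S.X) := measure_eq_zero_iff_ae_notMem.1 h
      filter_upwards [ae_forall_smul (G := Λ × Γ) h', S.ae_mem_goodSet, S.ae_existsUnique_Y]
        with s hs hgood hY hsX b
      obtain ⟨a, ha, -⟩ := hY b
      refine ⟨a, (hF s hgood a b).2 ⟨1, by simpa [← Prod.one_eq_mk] using hsX, ?_⟩⟩
      by_contra hX
      exact hs (a, b) ⟨ha, by simpa using hX⟩
    · intro h
      refine measure_eq_zero_iff_ae_notMem.2 ?_
      filter_upwards [ae_forall_smul (G := Λ × Γ) h, S.ae_mem_goodSet, S.ae_existsUnique_Y]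
        with s hs hgood hY hsYX
      obtain ⟨b, hb, hbu⟩ := hgood.1 1
      obtain ⟨a, ha⟩ := hs (1, b) hb b⁻¹
      rw [hFright s hgood b] at ha
      obtain ⟨c, hc, hac⟩ := (hF s hgood a _).1 ha
      obtain rfl : c = b := hbu c hc
      rw [inv_mul_cancel] at hac
      obtain rfl : a = 1 := (hY 1).unique (S.X_subset_Y hac)
        (by simpa [← Prod.one_eq_mk] using hsYX.1)
      exact hsYX.2 (by simpa [← Prod.one_eq_mk] using hac)

end SMICoupling

/-! ### From cocycles to couplings -/

section Construction

variable {Λ Γ : Type*} [Group Λ] [Group Γ]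

theorem isFundamentalDomain_inl_range {T : Type*} [MeasurableSpace T] {μ : Measure T}
    [MulAction (Λ × Γ) T] {Y : Set T} (hYm : MeasurableSet Y)
    (hY : ∀ s, ∃! a : Λ, (a, (1 : Γ)) • s ∈ Y) :
    IsFundamentalDomain (MonoidHom.inl Λ Γ).range Y μ := by
  refine .mk' hYm.nullMeasurableSet fun s => ?_
  obtain ⟨a, ha, hu⟩ := hY s
  refine ⟨⟨_, a, rfl⟩, ha, ?_⟩
  rintro ⟨_, a', rfl⟩ h'
  simpa using hu a' h'

theorem isFundamentalDomain_inr_range {T : Type*} [MeasurableSpace T] {μ : Measure T}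
    [MulAction (Λ × Γ) T] {X : Set T} (hXm : MeasurableSet X)
    (hX : ∀ s, ∃! b : Γ, ((1 : Λ), b) • s ∈ X) :
    IsFundamentalDomain (MonoidHom.inr Λ Γ).range X μ := by
  refine .mk' hXm.nullMeasurableSet fun s => ?_
  obtain ⟨b, hb, hu⟩ := hX s
  refine ⟨⟨_, b, rfl⟩, hb, ?_⟩
  rintro ⟨_, b', rfl⟩ h'
  simpa using hu b' h'

/-- A coupling on a standard Borel space in an arbitrary universe, with strict fundamental domains.
It is transported to `Type` along an embedding of the space into the real line. -/
theorem exists_coupling_of_space {T : Type*} [MeasurableSpace T] [StandardBorelSpace T]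
    (μ : Measure T) (hμ : μ ≠ 0) [MulAction (Λ × Γ) T] [MeasurableConstSMul (Λ × Γ) T]
    [SMulInvariantMeasure (Λ × Γ) T μ] (X Y : Set T) (hXm : MeasurableSet X)
    (hYm : MeasurableSet Y) (hX : ∀ s, ∃! b : Γ, ((1 : Λ), b) • s ∈ X)
    (hY : ∀ s, ∃! a : Λ, (a, (1 : Γ)) • s ∈ Y) (hμX : μ X < ∞) (hXY : X ⊆ Y) :
    ∃ S : SMICoupling Λ Γ, S.index = μ Y / μ X := by
  obtain ⟨e, he⟩ := exists_measurableEmbedding_real T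
  let φ : T ≃ᵐ Set.range e := he.equivRange
  have : StandardBorelSpace (Set.range e) := he.measurableSet_range.standardBorel
  let mact : MulAction (Λ × Γ) (Set.range e) := φ.symm.toEquiv.mulAction (Λ × Γ)
  have hsmul : ∀ (g : Λ × Γ) (s : Set.range e), g • s = φ (g • φ.symm s) := fun _ _ => rfl
  have mconst : MeasurableConstSMul (Λ × Γ) (Set.range e) :=
    ⟨fun g => φ.measurable.comp ((measurable_const_smul g).comp φ.symm.measurable)⟩
  have hpres : ∀ g : Λ × Γ, MeasurePreserving (fun s => g • s) (μ.map φ) (μ.map φ) := fun g =>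
    ((φ.measurable.measurePreserving μ).comp (measurePreserving_smul g μ)).comp
      (φ.measurable.measurePreserving μ).symm
  have minv : SMulInvariantMeasure (Λ × Γ) (Set.range e) (μ.map φ) :=
    ⟨fun g A hA => (hpres g).measure_preimage hA.nullMeasurableSet⟩
  have hmap : ∀ A : Set T, μ.map φ (φ.symm ⁻¹' A) = μ A := fun A => by
    rw [φ.map_apply, ← Set.preimage_comp, φ.symm_comp_self, Set.preimage_id]
  refine ⟨{ space := Set.range e
            μ := μ.map φ
            measure_ne_zero := by rwa [Ne, Measure.map_eq_zero_iff φ.measurable.aemeasurable]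
            Y := φ.symm ⁻¹' Y
            X := φ.symm ⁻¹' X
            measurableSet_Y := φ.symm.measurable hYm
            measurableSet_X := φ.symm.measurable hXm
            isFundamentalDomain_Y := isFundamentalDomain_inl_range (φ.symm.measurable hYm)
              fun s => by simpa [hsmul] using hY (φ.symm s)
            isFundamentalDomain_X := isFundamentalDomain_inr_range (φ.symm.measurable hXm)
              fun s => by simpa [hsmul] using hX (φ.symm s)
            measure_X_lt_top := by rwa [hmap]
            X_subset_Y := Set.preimage_mono hXY }, ?_⟩
  rw [SMICoupling.index]
  exact congrArg₂ _ (hmap Y) (hmap X)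

/-- A finite measure preserving action of `Λ` on `Ω` and a cocycle `α : Λ × Ω → Γ` with
`α a x ≠ 1` for `a ≠ 1` give a coupling on `Ω × Γ`, with `X = Ω × {1}`. Its index is `1` if almost
all maps `a ↦ α a x` are surjective, and it is infinite if there are infinitely many sets `B × {g n}`
of the same positive measure whose `Λ`-translates are disjoint. -/
theorem exists_coupling_of_cocycle [Countable Λ] [Countable Γ] {Ω : Type*} [MeasurableSpace Ω]
    [StandardBorelSpace Ω] [MulAction Λ Ω] [MeasurableConstSMul Λ Ω] (P : Measure Ω)
    [IsFiniteMeasure P] (hP : P ≠ 0) [SMulInvariantMeasure Λ Ω P] (α : Λ → Ω → Γ)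
    (hαm : ∀ a b, MeasurableSet {x | α a x = b})
    (hmul : ∀ a a' x, α (a * a') x = α a (a' • x) * α a' x) (hone : ∀ a x, α a x = 1 → a = 1) :
    ∃ S : SMICoupling Λ Γ,
      ((∀ᵐ x ∂P, Function.Surjective fun a => α a x) → S.index = 1) ∧
      ∀ B : Set Ω, MeasurableSet B → P B ≠ 0 → ∀ g : ℕ → Γ, Function.Injective g →
        (∀ x ∈ B, ∀ a : Λ, a • x ∈ B → ∀ m n, α a x * g m = g n → a = 1) → S.index = ∞ := by
  let mΓ : MeasurableSpace Γ := ⊤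
  have : DiscreteMeasurableSpace Γ := ⟨fun _ => trivial⟩
  have hα1 : ∀ x, α 1 x = 1 := fun x => by simpa using hmul 1 1 x
  have hαm' : ∀ a, Measurable (α a) := fun a => measurable_to_countable' fun b => hαm a b
  let mact : MulAction (Λ × Γ) (Ω × Γ) :=
    { smul := fun p s => (p.1 • s.1, α p.1 s.1 * s.2 * p.2⁻¹)
      one_smul := fun s => by
        change (_, _) = s
        simp [hα1]
      mul_smul := fun p q s => by
        change ((p.1 * q.1) • s.1, α (p.1 * q.1) s.1 * s.2 * (p.2 * q.2)⁻¹) =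
          (p.1 • q.1 • s.1, α p.1 (q.1 • s.1) * (α q.1 s.1 * s.2 * q.2⁻¹) * p.2⁻¹)
        simp [hmul, mul_smul, mul_assoc] }
  have hsmul : ∀ (a : Λ) (b : Γ) (x : Ω) (g : Γ),
    (a, b) • (x, g) = (a • x, α a x * g * b⁻¹) := fun _ _ _ _ => rfl
  let μ : Measure (Ω × Γ) := P.prod Measure.count
  have hpres : ∀ p : Λ × Γ, MeasurePreserving (fun s : Ω × Γ => p • s) μ μ := fun p => by
    refine (measurePreserving_smul p.1 P).skew_product
      (g := fun x g => α p.1 x * g * p.2⁻¹) ?_ (ae_of_all _ fun x => ?_)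
    · exact (measurable_from_prod_countable_left fun g => by
        exact (measurable_of_countable fun c : Γ => c * g * p.2⁻¹).comp (hαm' p.1))
    · let ψ : Γ ≃ Γ := (Equiv.mulLeft (α p.1 x)).trans (Equiv.mulRight p.2⁻¹)
      refine Measure.ext fun A hA => ?_
      rw [Measure.map_apply (measurable_of_countable _) hA]
      change Measure.count (ψ ⁻¹' A) = _
      rw [← ψ.image_symm_eq_preimage, Measure.count_injective_image ψ.symm.injective]
  have mconst : MeasurableConstSMul (Λ × Γ) (Ω × Γ) := ⟨fun p => (hpres p).measurable⟩
  have minv : SMulInvariantMeasure (Λ × Γ) (Ω × Γ) μ :=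
    ⟨fun p A hA => (hpres p).measure_preimage hA.nullMeasurableSet⟩
  -- An enumeration of `Γ` that starts with `1`.
  obtain ⟨enc, henc, henc1⟩ : ∃ enc : Γ → ℕ, Function.Injective enc ∧ enc 1 = 0 := by
    classical
    obtain ⟨f, hf⟩ := exists_injective_nat Γ
    refine ⟨fun g => if g = 1 then 0 else f g + 1, fun g g' h => ?_, if_pos rfl⟩
    by_cases h1 : g = 1 <;> by_cases h2 : g' = 1 <;> simp_all [hf.eq_iff]
  let X : Set (Ω × Γ) := {s | s.2 = 1}
  -- Each `Λ`-orbit has exactly one point whose second coordinate is the first in the enumeration.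
  let Y : Set (Ω × Γ) := {s | ∀ a, enc s.2 ≤ enc (α a s.1 * s.2)}
  have hXm : MeasurableSet X := measurable_snd (MeasurableSet.singleton (1 : Γ))
  have hYm : MeasurableSet Y := by
    have : Y = ⋂ a, {s | enc s.2 ≤ enc (α a s.1 * s.2)} := by
      ext s
      simp [Y]
    rw [this]
    refine MeasurableSet.iInter fun a => measurableSet_le
      ((measurable_of_countable enc).comp measurable_snd) ?_
    exact (measurable_of_countable fun c : Γ × Γ => enc (c.1 * c.2)).comp
      (((hαm' a).comp measurable_fst).prodMk measurable_snd)
  have hX : ∀ s, ∃! b : Γ, ((1 : Λ), b) • s ∈ X := by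
    rintro ⟨x, g⟩
    refine ⟨g, by simp [X, hsmul, hα1], fun b hb => ?_⟩
    have : g * b⁻¹ = 1 := by simpa [X, hsmul, hα1] using hb
    exact (mul_inv_eq_one.1 this).symm
  have hY : ∀ s, ∃! a : Λ, (a, (1 : Γ)) • s ∈ Y := by
    rintro ⟨x, g⟩
    have hmem : ∀ a, (a, (1 : Γ)) • (x, g) ∈ Y ↔ ∀ a', enc (α a x * g) ≤ enc (α a' x * g) := by
      intro a
      simp only [Y, hsmul, Set.mem_ofPred_eq, inv_one, mul_one, ← mul_assoc, ← hmul]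
      exact ⟨fun h a' => by simpa using h (a' * a⁻¹), fun h a' => h _⟩
    refine ⟨Function.argmin (fun a => enc (α a x * g)), (hmem _).2 fun a' =>
      Function.argmin_le (fun a => enc (α a x * g)) a', fun a ha => ?_⟩
    generalize hb : Function.argmin (fun a => enc (α a x * g)) = b
    have hb' : ∀ a', enc (α b x * g) ≤ enc (α a' x * g) := fun a' =>
      hb ▸ Function.argmin_le (fun a => enc (α a x * g)) a'
    have h1 : α a x = α b x :=
      mul_right_cancel (henc (le_antisymm ((hmem a).1 ha b) (hb' a)))
    have h2 := hmul (a * b⁻¹) b x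
    rw [inv_mul_cancel_right, h1] at h2
    exact mul_inv_eq_one.1 (hone _ _ (right_eq_mul.1 h2))
  have hμprod : ∀ (B : Set Ω) (C : Set Γ), μ (B ×ˢ C) = P B * Measure.count C := fun B C =>
    Measure.prod_prod B C
  have hμX : μ X = P Set.univ := by
    have : X = Set.univ ×ˢ {1} := by
      ext s
      simp [X]
    rw [this, hμprod, Measure.count_singleton, mul_one]
  have hPuniv : P Set.univ ≠ 0 := by rwa [Ne, Measure.measure_univ_eq_zero]
  have hXY : X ⊆ Y := by
    rintro ⟨x, g⟩ (rfl : g = 1) a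
    simp [henc1]
  obtain ⟨S, hS⟩ := exists_coupling_of_space μ
    (fun h => hPuniv (by rw [← hμX, h, Measure.coe_zero, Pi.zero_apply])) X Y hXm hYm hX hY
    (hμX ▸ measure_lt_top P _) hXY
  refine ⟨S, fun hsurj => ?_, fun B hB hPB g hg hdisj => ?_⟩
  · have hYX : Y =ᵐ[μ] X := by
      have h1 : ∀ᵐ s ∂μ, Function.Surjective fun a => α a s.1 :=
        Measure.quasiMeasurePreserving_fst.ae hsurj
      filter_upwards [h1] with s hs
      refine propext ⟨fun hsY => ?_, fun h => hXY h⟩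
      obtain ⟨a, ha⟩ := hs s.2⁻¹
      have h2 := hsY a
      beta_reduce at ha
      rw [ha, inv_mul_cancel, henc1, nonpos_iff_eq_zero, ← henc1] at h2
      exact henc h2
    rw [hS, measure_congr hYX, hμX, ENNReal.div_self hPuniv (measure_ne_top P _)]
  · have hfin : Set.Infinite (Set.range g) := Set.infinite_range_of_injective hg
    have hZ : μ (B ×ˢ Set.range g) = ∞ := by
      rw [hμprod, Measure.count_apply_infinite hfin, ENNReal.mul_top hPB]
    have : Countable (MonoidHom.inl Λ Γ).range :=
      (MonoidHom.inl Λ Γ).rangeRestrict_surjective.countable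
    have hle : μ (B ×ˢ Set.range g) ≤ μ Y := by
      refine (isFundamentalDomain_inl_range (μ := μ) hYm hY).measure_le_of_pairwise_disjoint
        (hB.prod (.of_discrete)).nullMeasurableSet ?_
      rintro ⟨_, a, rfl⟩ ⟨_, a', rfl⟩ hne
      refine Disjoint.aedisjoint (Disjoint.mono Set.inter_subset_left Set.inter_subset_left ?_)
      rw [Set.disjoint_left]
      rintro s ⟨⟨x, _⟩, ⟨hx, m, rfl⟩, rfl⟩ ⟨⟨x', _⟩, ⟨hx', n, rfl⟩, h⟩
      have h' : (a' • x', α a' x' * g n * 1⁻¹) = (a • x, α a x * g m * 1⁻¹) := h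
      rw [Prod.mk.injEq, mul_left_inj] at h'
      obtain ⟨h1, h2⟩ := h'
      have hxx' : (a'⁻¹ * a) • x = x' := by rw [mul_smul, ← h1, inv_smul_smul]
      have h3 : α (a'⁻¹ * a) x * g m = g n := by
        refine mul_left_cancel (a := α a' x') ?_
        rw [h2, ← mul_assoc, ← hxx', ← hmul, mul_inv_cancel_left]
      have h4 := hdisj x hx (a'⁻¹ * a) (hxx' ▸ hx') m n h3
      exact hne (Subtype.ext (congrArg (MonoidHom.inl Λ Γ) (inv_mul_eq_one.1 h4).symm))
    rw [hS, top_le_iff.1 (hZ.symm.le.trans hle), hμX, ENNReal.top_div_of_ne_top (measure_ne_top P _)]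

end Construction

/-! ### Alternating words -/

section AltWord

variable {V : Type*} {G : V → Type*}

/-- The alternating word of `k` copies of `e * b`, where `e` has type `u` and `b` has type `v`. -/
def altWord {u v : V} (e : G u) (b : G v) : ℕ → List (Σ v, G v)
  | 0 => []
  | k + 1 => ⟨u, e⟩ :: ⟨v, b⟩ :: altWord e b k

theorem altWord_succ {u v : V} (e : G u) (b : G v) (k : ℕ) :
    altWord e b (k + 1) = altWord e b k ++ [⟨u, e⟩, ⟨v, b⟩] := by
  induction k with
  | zero => rfl
  | succ k ih =>
    change ⟨u, e⟩ :: ⟨v, b⟩ :: altWord e b (k + 1) = (⟨u, e⟩ :: ⟨v, b⟩ :: altWord e b k) ++ _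
    rw [ih]
    rfl

theorem isChain_altWord {u v : V} (huv : u ≠ v) (e : G u) (b : G v) (k : ℕ) :
    (altWord e b k).IsChain fun s t => s.1 ≠ t.1 := by
  induction k with
  | zero => simp [altWord]
  | succ k ih =>
    cases k with
    | zero => simp [altWord, huv]
    | succ k =>
      simp only [altWord, List.isChain_cons_cons] at ih ⊢
      exact ⟨huv, huv.symm, ih⟩

variable [∀ v, Group (G v)]

theorem wordProd_altWord {M : Type*} [Monoid M] (ι : ∀ v, G v →* M) {u v : V} (e : G u) (b : G v)
    (k : ℕ) : wordProd ι (altWord e b k) = (ι u e * ι v b) ^ k := by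
  induction k with
  | zero => simp [altWord]
  | succ k ih => simp [altWord, ih, pow_succ', mul_assoc]

theorem ne_one_of_mem_altWord {u v : V} {e : G u} {b : G v} (he : e ≠ 1) (hb : b ≠ 1) (k : ℕ) :
    ∀ s ∈ altWord e b k, s.2 ≠ 1 := by
  induction k with
  | zero => simp [altWord]
  | succ k ih => simpa [altWord, he, hb] using ih

end AltWord

/-! ### The cocycle between graph products -/

section Cocycle

variable {V : Type*} [DecidableEq V] {H G : V → Type*} [∀ v, Group (H v)] [∀ v, Group (G v)]

/-- The image of a word under a family `x` of normalized injections, read from the right: a letter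
`a` of type `v` is mapped by the `v`-component of the translate of `x` by the letters to the right
of `a`. -/
def pushWord : List (Σ v, H v) → (∀ v, NormalizedInjection (H v) (G v)) → List (Σ v, G v)
  | [], _ => []
  | s :: l, x => ⟨s.1, (wordProd (MonoidHom.mulSingle H) l • x) s.1 s.2⟩ :: pushWord l x

theorem pushWord_append (l l' : List (Σ v, H v)) (x : ∀ v, NormalizedInjection (H v) (G v)) :
    pushWord (l ++ l') x =
      pushWord l (wordProd (MonoidHom.mulSingle H) l' • x) ++ pushWord l' x := by
  induction l with
  | nil => rfl
  | cons s l ih => simp [pushWord, ih, mul_smul]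

@[simp]
theorem map_fst_pushWord (l : List (Σ v, H v)) (x : ∀ v, NormalizedInjection (H v) (G v)) :
    (pushWord l x).map Sigma.fst = l.map Sigma.fst := by
  induction l with
  | nil => rfl
  | cons s l ih => simp [pushWord, ih]

theorem ne_one_of_mem_pushWord {l : List (Σ v, H v)} (hl : ∀ s ∈ l, s.2 ≠ 1)
    (x : ∀ v, NormalizedInjection (H v) (G v)) : ∀ s ∈ pushWord l x, s.2 ≠ 1 := by
  induction l with
  | nil => simp [pushWord]
  | cons s l ih =>
    simp only [pushWord, List.mem_cons, forall_eq_or_imp] at hl ⊢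
    refine ⟨fun h => hl.1 ?_, ih hl.2⟩
    rw [← NormalizedInjection.map_one ((wordProd (MonoidHom.mulSingle H) l • x) s.1)] at h
    exact NormalizedInjection.injective _ h

/-- Pushing words forward commutes with deleting all letters whose type fails `p`. -/
theorem filter_pushWord (p : V → Bool) (l : List (Σ v, H v))
    (x : ∀ v, NormalizedInjection (H v) (G v)) :
    (pushWord l x).filter (fun s => p s.1) = pushWord (l.filter fun s => p s.1) x := by
  have key : ∀ (l : List (Σ v, H v)) (v : V), p v → wordProd (MonoidHom.mulSingle H) l v =
      wordProd (MonoidHom.mulSingle H) (l.filter fun s => p s.1) v := by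
    intro l v hv
    induction l with
    | nil => rfl
    | cons s l ih =>
      by_cases hs : p s.1
      · simp [hs, ih]
      · have hne : v ≠ s.1 := fun h => hs (h ▸ hv)
        simp [hs, ih, Pi.mulSingle_eq_of_ne hne]
  induction l with
  | nil => rfl
  | cons s l ih =>
    by_cases hs : p s.1
    · simp only [pushWord, hs, List.filter_cons_of_pos, ih, Pi.smul_apply', key l s.1 hs]
    · simp [pushWord, hs, ih]

variable {K : Type*} [Group K]

/-- For homomorphisms `ι v : G v →* K`, the skew product action of `H v` on
`(∀ v, NormalizedInjection (H v) (G v)) × K`. -/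
def skewAct (ι : ∀ v, G v →* K) (v : V) :
    H v →* Function.End ((∀ v, NormalizedInjection (H v) (G v)) × K) where
  toFun a := fun p => (Pi.mulSingle v a • p.1, ι v (p.1 v a) * p.2)
  map_one' := by
    funext p
    change (_, _) = p
    simp
  map_mul' a b := by
    funext p
    change (_, _) = (_, _)
    simp [Pi.mulSingle_mul, mul_smul, NormalizedInjection.apply_mul, mul_assoc]

theorem skewAct_apply (ι : ∀ v, G v →* K) (v : V) (a : H v)
    (p : (∀ v, NormalizedInjection (H v) (G v)) × K) :
    skewAct ι v a p = (Pi.mulSingle v a • p.1, ι v (p.1 v a) * p.2) := rfl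

theorem wordProd_skewAct_apply (ι : ∀ v, G v →* K) (l : List (Σ v, H v))
    (x : ∀ v, NormalizedInjection (H v) (G v)) (k : K) :
    wordProd (skewAct ι) l (x, k) =
      (wordProd (MonoidHom.mulSingle H) l • x, wordProd ι (pushWord l x) * k) := by
  induction l with
  | nil =>
    rw [pushWord, wordProd_nil, wordProd_nil, wordProd_nil, one_smul, one_mul]
    rfl
  | cons s l ih =>
    rw [wordProd_cons]
    change skewAct ι s.1 s.2 (wordProd (skewAct ι) l (x, k)) = _
    rw [ih, skewAct_apply]
    simp [pushWord, mul_smul, mul_assoc]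

/-- Words with the same value in the free product have images with the same value. -/
theorem wordProd_pushWord_congr {l l' : List (Σ v, H v)}
    (h : wordProd (fun v => (Monoid.CoprodI.of : H v →* Monoid.CoprodI H)) l =
      wordProd (fun _ => Monoid.CoprodI.of) l') (x : ∀ v, NormalizedInjection (H v) (G v)) :
    wordProd (fun v => (Monoid.CoprodI.of : G v →* Monoid.CoprodI G)) (pushWord l x) =
      wordProd (fun _ => Monoid.CoprodI.of) (pushWord l' x) := by
  let ι : ∀ v, G v →* Monoid.CoprodI G := fun _ => Monoid.CoprodI.of
  have h1 := congrArg (Monoid.CoprodI.lift (skewAct (H := H) ι)) h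
  simp only [map_wordProd, Monoid.CoprodI.lift_comp_of] at h1
  have h2 := congrArg Prod.snd (congrFun h1 (x, 1))
  simpa only [wordProd_skewAct_apply, mul_one] using h2

namespace GraphProduct

variable (Θ : SimpleGraph V)

theorem commute_skewAct {u v : V} (h : Θ.Adj u v) (a : H u) (b : H v) :
    Commute (skewAct (of Θ G) u a) (skewAct (of Θ G) v b) := by
  have huv := h.ne
  funext p
  change skewAct (of Θ G) u a (skewAct (of Θ G) v b p) =
    skewAct (of Θ G) v b (skewAct (of Θ G) u a p)
  simp only [skewAct_apply, Pi.smul_apply', Pi.mulSingle_eq_of_ne huv,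
    Pi.mulSingle_eq_of_ne huv.symm, one_smul, ← mul_smul, ← mul_assoc,
    (Pi.mulSingle_commute huv a b).eq, (commute_of h (p.1 u a) (p.1 v b)).eq]

/-- The projection of the graph product to the direct product of the vertex groups. -/
def toPi : GraphProduct Θ H →* ∀ v, H v :=
  lift (MonoidHom.mulSingle H) fun _ _ h => Pi.mulSingle_commute h.ne

theorem toPi_wordProd (l : List (Σ v, H v)) :
    toPi Θ (wordProd (of Θ H) l) = wordProd (MonoidHom.mulSingle H) l :=
  lift_wordProd _ _ l

/-- The cocycle of the graph product of the `H v` with values in the graph product of the `G v`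
defined by families of normalized injections: it extends the cocycles `(a, x) ↦ x v a` of the vertex
groups. -/
def cocycle (h : GraphProduct Θ H) (x : ∀ v, NormalizedInjection (H v) (G v)) :
    GraphProduct Θ G :=
  (lift (skewAct (of Θ G)) (fun _ _ => commute_skewAct Θ) h (x, 1)).2

theorem cocycle_wordProd (l : List (Σ v, H v)) (x : ∀ v, NormalizedInjection (H v) (G v)) :
    cocycle Θ (wordProd (of Θ H) l) x = wordProd (of Θ G) (pushWord l x) := by
  rw [cocycle, lift_wordProd, wordProd_skewAct_apply, mul_one]

theorem cocycle_mul (h h' : GraphProduct Θ H) (x : ∀ v, NormalizedInjection (H v) (G v)) :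
    cocycle Θ (h * h') x = cocycle Θ h (toPi Θ h' • x) * cocycle Θ h' x := by
  obtain ⟨l, rfl⟩ := wordProd_surjective h
  obtain ⟨l', rfl⟩ := wordProd_surjective h'
  rw [← wordProd_append, cocycle_wordProd, cocycle_wordProd, cocycle_wordProd, pushWord_append,
    wordProd_append, toPi_wordProd]

theorem eq_one_of_cocycle_eq_one {h : GraphProduct Θ H}
    {x : ∀ v, NormalizedInjection (H v) (G v)} (h1 : cocycle Θ h x = 1) : h = 1 := by
  obtain ⟨l, rfl, hl, hred⟩ := exists_reduced h
  rw [cocycle_wordProd] at h1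
  have h2 := congrArg (List.map Sigma.fst) <|
    eq_nil_of_wordProd_eq_one (ne_one_of_mem_pushWord hl x) (by simpa using hred) h1
  rw [map_fst_pushWord, List.map_nil, List.map_eq_nil_iff] at h2
  rw [h2, wordProd_nil]

theorem cocycle_surjective {x : ∀ v, NormalizedInjection (H v) (G v)}
    (hx : ∀ v, Function.Surjective (x v)) : Function.Surjective fun h => cocycle Θ h x := by
  intro g
  obtain ⟨m, rfl⟩ := wordProd_surjective g
  suffices ∃ l, pushWord l x = m by
    obtain ⟨l, rfl⟩ := this
    exact ⟨_, cocycle_wordProd Θ l x⟩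
  induction m with
  | nil => exact ⟨[], rfl⟩
  | cons s m ih =>
    obtain ⟨l, rfl⟩ := ih
    obtain ⟨v, b⟩ := s
    -- The translate of `x v` that `pushWord` applies to the next letter is surjective as well.
    obtain ⟨c, hc⟩ := hx v (b * x v (wordProd (MonoidHom.mulSingle H) l v))
    refine ⟨⟨v, c * (wordProd (MonoidHom.mulSingle H) l v)⁻¹⟩ :: l, ?_⟩
    simp [pushWord, NormalizedInjection.smul_apply, hc]

theorem measurableSet_cocycle_eq [∀ v, Countable (G v)] [Countable V] (h : GraphProduct Θ H)
    (g : GraphProduct Θ G) :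
    MeasurableSet {x : ∀ v, NormalizedInjection (H v) (G v) | cocycle Θ h x = g} := by
  obtain ⟨l, rfl⟩ := wordProd_surjective h
  simp only [cocycle_wordProd]
  induction l generalizing g with
  | nil => simp [pushWord]
  | cons s l ih =>
    obtain ⟨v, a⟩ := s
    have : {x : ∀ v, NormalizedInjection (H v) (G v) |
        wordProd (of Θ G) (pushWord (⟨v, a⟩ :: l) x) = g} =
        ⋃ b : G v, {x | (wordProd (MonoidHom.mulSingle H) l v • x v) a = b} ∩
          {x | wordProd (of Θ G) (pushWord l x) = (of Θ G v b)⁻¹ * g} := by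
      ext x
      simp [pushWord, eq_inv_mul_iff_mul_eq]
    rw [this]
    have hm : Measurable fun x : ∀ v, NormalizedInjection (H v) (G v) =>
        wordProd (MonoidHom.mulSingle H) l v • x v :=
      (measurable_const_smul _).comp (measurable_pi_apply v)
    exact MeasurableSet.iUnion fun b =>
      (hm (NormalizedInjection.measurableSet_apply_eq a b)).inter (ih _)

/-- The retraction of the graph product to the free product of two nonadjacent vertex groups,
followed by the inclusion into the free product of all vertex groups. -/
def retract {u v : V} (huv : ¬ Θ.Adj u v) : GraphProduct Θ G →* Monoid.CoprodI G :=
  lift (fun w => if w = u ∨ w = v then Monoid.CoprodI.of else 1) <| by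
    intro w w' h a b
    by_cases hw : w = u ∨ w = v
    · by_cases hw' : w' = u ∨ w' = v
      · rcases hw with rfl | rfl <;> rcases hw' with rfl | rfl
        · exact (h.ne rfl).elim
        · exact (huv h).elim
        · exact (huv h.symm).elim
        · exact (h.ne rfl).elim
      · simp [hw']
    · simp [hw]

theorem retract_wordProd {u v : V} (huv : ¬ Θ.Adj u v) (m : List (Σ v, G v)) :
    retract Θ huv (wordProd (of Θ G) m) = wordProd (fun _ => Monoid.CoprodI.of)
      (m.filter fun s => decide (s.1 = u ∨ s.1 = v)) := by
  rw [retract, lift_wordProd]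
  induction m with
  | nil => rfl
  | cons s m ih =>
    by_cases hs : s.1 = u ∨ s.1 = v <;> simp [hs, ih]

/-- If `b` is not in the range of `x v`, then no value of the cocycle at `x` is a nontrivial power
of `e * b`, for `e ≠ 1` in a vertex group that is not adjacent to `v`: in the free product, the
last letter of the normal form of a value is `x u a` or `x v a` for some `a`. -/
theorem cocycle_ne_pow {u v : V} (hne : u ≠ v) (huv : ¬ Θ.Adj u v) {e : G u} (he : e ≠ 1)
    {b : G v} {x : ∀ v, NormalizedInjection (H v) (G v)} (hb : ∀ a, x v a ≠ b)
    (h : GraphProduct Θ H) (k : ℕ) :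
    cocycle Θ h x ≠ (of Θ G u e * of Θ G v b) ^ (k + 1) := by
  classical
  intro heq
  have hb1 : b ≠ 1 := fun h1 => hb 1 (by rw [h1, NormalizedInjection.map_one])
  obtain ⟨l, rfl⟩ := wordProd_surjective h
  rw [cocycle_wordProd, ← wordProd_altWord] at heq
  have h1 := congrArg (retract Θ huv) heq
  have halt : (altWord e b (k + 1)).filter (fun s => decide (s.1 = u ∨ s.1 = v)) =
      altWord e b (k + 1) := by
    refine List.filter_eq_self.2 ?_
    generalize k + 1 = n
    induction n with
    | zero => simp [altWord]
    | succ n ih => simpa [altWord] using ih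
  rw [retract_wordProd, retract_wordProd, halt,
    filter_pushWord (fun w => decide (w = u ∨ w = v))] at h1
  generalize l.filter (fun s => decide (s.1 = u ∨ s.1 = v)) = l' at h1
  obtain ⟨w, hw⟩ := (Monoid.CoprodI.Word.equiv (M := H)).symm.surjective
    (wordProd (fun _ => Monoid.CoprodI.of) l')
  have hw' : wordProd (fun _ => Monoid.CoprodI.of) w.toList =
    wordProd (fun _ => Monoid.CoprodI.of) l' := hw
  rw [← wordProd_pushWord_congr hw'] at h1
  let w₁ : Monoid.CoprodI.Word G :=
    ⟨pushWord w.toList x, ne_one_of_mem_pushWord w.ne_one x, by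
      have := w.chain_ne
      rw [← List.isChain_map (R := (· ≠ ·)) Sigma.fst] at this ⊢
      rwa [map_fst_pushWord]⟩
  let w₂ : Monoid.CoprodI.Word G :=
    ⟨altWord e b (k + 1), ne_one_of_mem_altWord he hb1 _, isChain_altWord hne e b _⟩
  have h2 : w₁ = w₂ := (Monoid.CoprodI.Word.equiv (M := G)).symm.injective h1
  have h3 : pushWord w.toList x = altWord e b (k + 1) :=
    congrArg Monoid.CoprodI.Word.toList h2
  rw [altWord_succ] at h3
  rcases List.eq_nil_or_concat w.toList with h4 | ⟨l₀, s, h4⟩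
  · rw [h4] at h3
    simp [pushWord] at h3
  · rw [h4, List.concat_eq_append, pushWord_append] at h3
    have h5 := congrArg List.getLast? h3
    simp only [pushWord, wordProd_nil, one_smul, List.getLast?_append, List.getLast?_cons_cons,
      List.getLast?_singleton, Option.some_or, Option.some.injEq] at h5
    obtain ⟨v', a⟩ := s
    obtain rfl : v' = v := congrArg Sigma.fst h5
    exact hb a (eq_of_heq (Sigma.mk.inj h5).2)

end GraphProduct

end Cocycle

/-! ### Graph products of couplings -/

theorem Group.FG.countable {A : Type*} [Group A] (h : Group.FG A) : Countable A := by
  obtain ⟨S, hS⟩ := h.out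
  have : Function.Surjective (FreeGroup.lift fun s : S => (s : A)) := by
    rw [← MonoidHom.range_eq_top, FreeGroup.range_lift_eq_closure]
    simpa using hS
  exact this.countable

/-- In an irreducible graph with at least two vertices, no vertex is adjacent to all others. -/
theorem SimpleGraph.IsIrreducible.exists_not_adj {V : Type*} [Nontrivial V] {Θ : SimpleGraph V}
    (hΘ : Θ.IsIrreducible) (v : V) : ∃ u, u ≠ v ∧ ¬ Θ.Adj u v := by
  by_contra! h
  obtain ⟨u, hu⟩ := exists_ne v
  refine hΘ ⟨(⊤ : Θ.Subgraph).induce {v}, (⊤ : Θ.Subgraph).induce {v}ᶜ, ?_, ?_, ⟨v, rfl⟩,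
    ⟨u, hu⟩, by simp, fun a b => ?_⟩
  · intro a ha b hb hab
    exact ⟨ha, hb, hab⟩
  · intro a ha b hb hab
    exact ⟨ha, hb, hab⟩
  · by_cases ha : a = v <;> by_cases hb : b = v
    · subst ha hb
      simp
    · subst ha
      simp [hb, (h b hb).symm]
    · subst hb
      simp [ha, h a ha]
    · simp [ha, hb]

/-- The coupling of the graph products obtained from random normalized injections of the vertex
groups. -/
theorem exists_graphProduct_coupling {V : Type*} [Fintype V] (Θ : SimpleGraph V)
    {H G : V → Type*} [∀ v, Group (H v)] [∀ v, Group (G v)] [∀ v, Countable (H v)]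
    [∀ v, Countable (G v)] (P : ∀ v, Measure (NormalizedInjection (H v) (G v)))
    [∀ v, IsFiniteMeasure (P v)] (hP : ∀ v, P v ≠ 0)
    [∀ v, SMulInvariantMeasure (H v) (NormalizedInjection (H v) (G v)) (P v)] :
    ∃ S : SMICoupling (GraphProduct Θ H) (GraphProduct Θ G),
      ((∀ v, ∀ᵐ f : NormalizedInjection (H v) (G v) ∂P v, Function.Surjective f) →
        S.index = 1) ∧
      ∀ u v, u ≠ v → ¬ Θ.Adj u v → Nontrivial (G u) →
        (¬ ∀ᵐ f : NormalizedInjection (H v) (G v) ∂P v, Function.Surjective f) →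
        S.index = ∞ := by
  classical
  let Ω := ∀ v, NormalizedInjection (H v) (G v)
  let mact : MulAction (GraphProduct Θ H) Ω := MulAction.compHom Ω (GraphProduct.toPi Θ)
  have hsmul : ∀ (h : GraphProduct Θ H) (x : Ω), h • x = GraphProduct.toPi Θ h • x :=
    fun _ _ => rfl
  have hpres : ∀ h : GraphProduct Θ H,
      MeasurePreserving (fun x : Ω => h • x) (Measure.pi P) (Measure.pi P) := fun h =>
    measurePreserving_pi P P fun v => measurePreserving_smul (GraphProduct.toPi Θ h v) (P v)
  have mconst : MeasurableConstSMul (GraphProduct Θ H) Ω := ⟨fun h => (hpres h).measurable⟩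
  have minv : SMulInvariantMeasure (GraphProduct Θ H) Ω (Measure.pi P) :=
    ⟨fun h A hA => (hpres h).measure_preimage hA.nullMeasurableSet⟩
  have hP0 : Measure.pi P ≠ 0 := by
    rw [Ne, ← Measure.measure_univ_eq_zero, Measure.pi_univ, Finset.prod_eq_zero_iff]
    rintro ⟨v, -, hv⟩
    exact hP v (Measure.measure_univ_eq_zero.1 hv)
  obtain ⟨S, hS1, hS2⟩ := exists_coupling_of_cocycle (Measure.pi P) hP0 (GraphProduct.cocycle Θ)
    (GraphProduct.measurableSet_cocycle_eq Θ) (GraphProduct.cocycle_mul Θ)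
    fun _ _ => GraphProduct.eq_one_of_cocycle_eq_one Θ
  refine ⟨S, fun hsurj => hS1 ?_, fun u v hne huv hu hnot => ?_⟩
  · have : ∀ᵐ x ∂Measure.pi P, ∀ v, Function.Surjective (x v) :=
      ae_all_iff.2 fun v => (Measure.quasiMeasurePreserving_eval P v).ae (hsurj v)
    filter_upwards [this] with x hx
    exact GraphProduct.cocycle_surjective Θ hx
  · obtain ⟨b, hb⟩ : ∃ b, P v {f | ∀ a, f a ≠ b} ≠ 0 := by
      by_contra! h
      refine hnot (((ae_all_iff (p := fun (f : NormalizedInjection (H v) (G v)) b =>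
        ∃ a, f a = b)).2 fun b => ?_))
      rw [ae_iff]
      simpa using h b
    obtain ⟨e, he⟩ := exists_ne (1 : G u)
    let B : Set Ω := {x | ∀ a, x v a ≠ b}
    have hBv : MeasurableSet {f : NormalizedInjection (H v) (G v) | ∀ a, f a ≠ b} := by
      rw [Set.ofPred_forall]
      exact MeasurableSet.iInter fun a =>
        (NormalizedInjection.measurableSet_apply_eq a b).compl
    have heval : Measurable fun x : Ω => x v := measurable_pi_apply v
    have hB : MeasurableSet B := heval hBv
    have hPB : Measure.pi P B ≠ 0 := by
      have h1 := congrArg (fun Q => Q {f | ∀ a, f a ≠ b}) (Measure.pi_map_eval (μ := P) v)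
      rw [Measure.map_apply heval hBv, Measure.smul_apply, smul_eq_mul] at h1
      change Measure.pi P B = _ at h1
      rw [h1]
      refine mul_ne_zero (Finset.prod_ne_zero_iff.2 fun w _ => ?_) hb
      rw [Ne, Measure.measure_univ_eq_zero]
      exact hP w
    have hpow : ∀ x ∈ B, ∀ (h : GraphProduct Θ H) (k : ℕ), GraphProduct.cocycle Θ h x ≠
        (GraphProduct.of Θ G u e * GraphProduct.of Θ G v b) ^ (k + 1) :=
      fun x hx h k => GraphProduct.cocycle_ne_pow Θ hne huv he hx h k
    have hcocycle_one : ∀ x : Ω, GraphProduct.cocycle (G := G) Θ (1 : GraphProduct Θ H) x = 1 :=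
      fun x => by simpa [pushWord] using GraphProduct.cocycle_wordProd Θ [] x
    generalize GraphProduct.of Θ G u e * GraphProduct.of Θ G v b = g at hpow
    obtain ⟨x₀, hx₀⟩ : B.Nonempty := nonempty_of_measure_ne_zero hPB
    refine hS2 B hB hPB (fun n => g ^ n) ?_ fun x hx h hhx m n hmn => ?_
    · refine injective_pow_iff_not_isOfFinOrder.2 fun hfin => ?_
      obtain ⟨n, hn, hgn⟩ := isOfFinOrder_iff_pow_eq_one.1 hfin
      obtain ⟨k, rfl⟩ := Nat.exists_eq_succ_of_ne_zero hn.ne'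
      exact hpow x₀ hx₀ 1 k (by rw [hcocycle_one, hgn])
    · rcases lt_trichotomy m n with hlt | rfl | hlt
      · obtain ⟨k, rfl⟩ := Nat.exists_eq_add_of_lt hlt
        refine (hpow x hx h k (mul_right_cancel (b := g ^ m) ?_)).elim
        rw [hmn, ← pow_add]
        congr 1
        omega
      · exact GraphProduct.eq_one_of_cocycle_eq_one Θ (mul_eq_right.1 hmn)
      · obtain ⟨k, rfl⟩ := Nat.exists_eq_add_of_lt hlt
        -- The value of the cocycle is a negative power of `g`, so its value at `h⁻¹` and the point
        -- `h • x` of `B` is a positive power.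
        have h1 := GraphProduct.cocycle_mul (G := G) Θ h⁻¹ h x
        rw [inv_mul_cancel, hcocycle_one, ← hsmul] at h1
        rw [show n + k + 1 = k + 1 + n by omega, pow_add, ← mul_assoc,
          mul_eq_right, mul_eq_one_iff_eq_inv] at hmn
        rw [hmn, eq_comm, mul_inv_eq_one] at h1
        exact (hpow (h • x) hhx h⁻¹ k h1).elim

theorem theoremB {V : Type*} [Finite V] (Θ : SimpleGraph V) (hΘ : Θ.IsIrreducible)
    (H G : V → Type*) [∀ v, Group (H v)] [∀ v, Group (G v)]
    [∀ v, Nontrivial (H v)] [∀ v, Nontrivial (G v)]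
    (hH : ∀ v, Group.FG (H v)) (hG : ∀ v, Group.FG (G v))
    (c : V → ℝ≥0∞) (hc : ∀ v, SMIWithIndex (H v) (G v) (c v)) :
    SMI (GraphProduct Θ H) (GraphProduct Θ G) ∧
    ((∀ v, c v = 1) → SMIWithIndex (GraphProduct Θ H) (GraphProduct Θ G) 1) ∧
    (Nontrivial V → (∃ v, c v ≠ 1) →
      SMIWithIndex (GraphProduct Θ H) (GraphProduct Θ G) ∞) := by
  have : Fintype V := Fintype.ofFinite V
  have hHc : ∀ v, Countable (H v) := fun v => (hH v).countable
  have hGc : ∀ v, Countable (G v) := fun v => (hG v).countable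
  choose T hT using hc
  choose P hPfin hP0 hPinv hPindex using fun v => (T v).exists_invariant_measure
  obtain ⟨S, hS1, hS2⟩ := exists_graphProduct_coupling Θ P hP0
  refine ⟨⟨S⟩, fun h1 => ⟨S, hS1 fun v => (hPindex v).1 ((hT v).trans (h1 v))⟩, ?_⟩
  rintro hV ⟨v, hv⟩
  obtain ⟨u, hne, huv⟩ := hΘ.exists_not_adj v
  exact ⟨S, hS2 u v hne huv inferInstance fun h => hv ((hT v).symm.trans ((hPindex v).2 h))⟩
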